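/- Let $B=\{z\in\mathbb C^n : |z|<1\}$ be the unit ball, let $\sigma$ be the rotation-invariant $(2n-1)$-dimensional area measure on $\partial B$, and write $z\cdot\overline P=\sum_{j=1}^n z_j\overline{P_j}$. For $P\in\partial B$ and $\alpha>1$ let $$\mathcal A_\alpha(P)=\{z\in B : |1-z\cdot\overline P|<\alpha(1-|z|)\}.$$ Let $f$ be a holomorphic function on $B$, let $M>0$, and suppose that $|f|\le M$ on $B$. Let $E\subseteq\partial B$ be a set with $\sigma(E)>0$, and suppose that $f$ is admissibly bounded on $E$, that is, for each $P\in E$ there is an $\alpha=\alpha(P)>1$ such that $f$ is bounded on $\mathcal A_\alpha(P)$. Then $f$ has admissible limits at $\sigma$-almost every point of $E$: for $\sigma$-almost every $P\in E$, the limit $$\lim_{\mathcal A_\alpha(P)\ni z\to P} f(z)$$ exists for every $\alpha>1$. -/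

import Mathlib

open Filter Topology MeasureTheory

/-- The surface measure `σ` on the unit sphere `∂B` of `ℂⁿ`: the rotation-invariant
`(2n-1)`-dimensional area measure induced by Lebesgue measure on `ℂⁿ`. -/
noncomputable def sphereArea (n : ℕ) :
    Measure (Metric.sphere (0 : EuclideanSpace ℂ (Fin n)) 1) :=
  (volume : Measure (EuclideanSpace ℂ (Fin n))).toSphere

/-- The admissible approach region
`𝒜_α(P) = {z ∈ B : |1 - z · P̄| < α (1 - |z|)}` in the unit ball `B` of `ℂⁿ`.
Here `z · P̄ = ∑ j, z j * conj (P j)`, which is `inner ℂ P z`, since Mathlib's inner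
product is conjugate-linear in the first argument. -/
def admissibleRegion {n : ℕ} (α : ℝ) (P : EuclideanSpace ℂ (Fin n)) :
    Set (EuclideanSpace ℂ (Fin n)) :=
  {z | z ∈ Metric.ball (0 : EuclideanSpace ℂ (Fin n)) 1 ∧
    ‖1 - inner ℂ P z‖ < α * (1 - ‖z‖)}

/-- `f` is admissibly bounded on `E ⊆ ∂B`: for each `P ∈ E` there is an aperture
`α = α(P) > 1` such that `f` is bounded on `𝒜_α(P)` (with a bound depending on `P`). -/
def AdmissiblyBoundedOn {n : ℕ} (f : EuclideanSpace ℂ (Fin n) → ℂ)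
    (E : Set (Metric.sphere (0 : EuclideanSpace ℂ (Fin n)) 1)) : Prop :=
  ∀ P ∈ E, ∃ α : ℝ, 1 < α ∧
    ∃ C : ℝ, ∀ z ∈ admissibleRegion α (P : EuclideanSpace ℂ (Fin n)), ‖f z‖ ≤ C

/-- `f` has an admissible limit at `P ∈ ∂B`: for every aperture `α > 1`, the limit of `f z`
as `z → P` within `𝒜_α(P)` exists. -/
def HasAdmissibleLimitAt {n : ℕ} (f : EuclideanSpace ℂ (Fin n) → ℂ)
    (P : EuclideanSpace ℂ (Fin n)) : Prop :=
  ∀ α : ℝ, 1 < α → ∃ L : ℂ, Tendsto f (𝓝[admissibleRegion α P] P) (𝓝 L)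

/-! The bound on `|f|` gives admissible limits at almost every point of the whole sphere (Korányi's
theorem, `ae_hasAdmissibleLimitAt`), hence of `E`. No Poisson integral or maximal function is used.

Radial limits: a primitive of a bounded holomorphic function on the disc is Lipschitz, so its
boundary function is differentiable a.e., and this differentiability gives radial limits of the
original function (`ae_exists_tendsto_radial`). Slicing the ball by complex lines through 0 then
yields radial limits of `f` along σ-almost every direction. Hence, for each `ε`, almost every
direction lies in one of the countably many closed sets `radialSet f q ε N`.

From radial to admissible: the caps are balls of the metric `|1 - ω · P̄| ^ (1 / 2)`, for which σ is
doubling, so almost every point of a `radialSet` is a density point along caps. Near such a `P`, let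
`z` lie in an admissible region. By the sub-mean value property, `|f z - q|` is at most the average
of `|f - q|` over a nonisotropic box about `z` of size comparable to `1 - |z|`. On most of the box
`|f - q| ≤ ε`. The rest has small relative volume and `|f - q|` is bounded there, so `|f z - q| ≤
2ε`. Letting `ε → 0` through a sequence gives the Cauchy criterion. -/

/-! ### Fatou's theorem on the unit disc. -/

/-- A holomorphic function on the disc that is `O(z - 1)` everywhere and `o(z - 1)` along the unit
circle is `o(z - 1)` at `1`. -/
lemma norm_le_mul_sub_one_of_isLittleO_circle {G : ℂ → ℂ} {C : ℝ}
    (hGc : ContinuousOn G (Metric.closedBall 0 1))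
    (hGd : DifferentiableOn ℂ G (Metric.ball 0 1))
    (hGC : ∀ z ∈ Metric.closedBall (0 : ℂ) 1, ‖G z‖ ≤ C * ‖z - 1‖)
    (hGo : ∀ ε > 0, ∃ η > 0, ∀ ζ : ℂ, ‖ζ‖ = 1 → ‖ζ - 1‖ < η → ‖G ζ‖ ≤ ε * ‖ζ - 1‖)
    {ε : ℝ} (hε : 0 < ε) :
    ∃ κ > 0, ∀ z : ℂ, ‖z‖ < 1 → ‖z - 1‖ < κ → ‖G z‖ ≤ ε * ‖z - 1‖ := by
  have hC : 0 ≤ C := by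
    have := (norm_nonneg _).trans (hGC 0 (by simp))
    simpa using this
  obtain ⟨η, hη, hGη⟩ := hGo (ε / 2) (by positivity)
  set κ := η * (ε / 2) / (C + 1) with hκdef
  have hκ : 0 < κ := by positivity
  have hden : ∀ z : ℂ, ‖z‖ ≤ 1 → ∀ t : ℝ, 0 ≤ t →
      ‖z - 1‖ ≤ ‖(t : ℂ) + 1 - z‖ ∧ t ≤ ‖(t : ℂ) + 1 - z‖ := by
    intro z hz t ht
    have hre : z.re ≤ 1 := (Complex.re_le_norm z).trans hz
    constructor
    · rw [Complex.norm_def, Complex.norm_def]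
      apply Real.sqrt_le_sqrt
      simp only [Complex.normSq_apply, Complex.sub_re, Complex.sub_im, Complex.add_re,
        Complex.add_im, Complex.ofReal_re, Complex.ofReal_im, Complex.one_re, Complex.one_im]
      nlinarith
    · refine le_trans ?_ (Complex.re_le_norm _)
      simp
      linarith
  have hκG : ∀ z : ℂ, ‖z‖ < 1 → ∀ t : ℝ, 0 < t →
      κ * ‖G z‖ ≤ ε / 2 * (‖(κ : ℂ) + 1 - z‖ * ‖(t : ℂ) + 1 - z‖) := by
    intro z hz t ht
    have hne : ∀ w : ℂ, ‖w‖ ≤ 1 → ∀ s : ℝ, 0 < s → (s : ℂ) + 1 - w ≠ 0 := by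
      intro w hw s hs h
      have := (hden w hw s hs.le).2
      rw [h, norm_zero] at this
      linarith
    -- Maximum principle for `G` divided by a weight. On the circle near 1 the factor `κ + 1 - w`
    -- absorbs `κ`; away from 1 it is at least `η`, and `κ * C ≤ ε / 2 * η`. The shift `t > 0` keeps
    -- the other factor zero-free up to the boundary and is sent to 0 afterwards.
    set H : ℂ → ℂ := fun w => (κ : ℂ) * G w / (((κ : ℂ) + 1 - w) * ((t : ℂ) + 1 - w)) with hH
    have hHd : DiffContOnCl ℂ H (Metric.ball 0 1) := by
      constructor
      · apply DifferentiableOn.div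
        · exact (differentiableOn_const _).mul hGd
        · fun_prop
        · intro w hw
          have hw' : ‖w‖ ≤ 1 := by simpa using (Metric.mem_ball.1 hw).le
          exact mul_ne_zero (hne w hw' κ hκ) (hne w hw' t ht)
      · rw [closure_ball _ one_ne_zero]
        apply ContinuousOn.div
        · exact continuousOn_const.mul hGc
        · fun_prop
        · intro w hw
          have hw' : ‖w‖ ≤ 1 := by simpa using hw
          exact mul_ne_zero (hne w hw' κ hκ) (hne w hw' t ht)
    have hbd : ∀ w ∈ frontier (Metric.ball (0 : ℂ) 1), ‖H w‖ ≤ ε / 2 := by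
      intro w hw
      rw [frontier_ball _ one_ne_zero, mem_sphere_zero_iff_norm] at hw
      have h1 := hden w hw.le κ hκ.le
      have h2 := hden w hw.le t ht.le
      have hp : 0 < ‖(κ : ℂ) + 1 - w‖ * ‖(t : ℂ) + 1 - w‖ :=
        mul_pos (hκ.trans_le h1.2) (ht.trans_le h2.2)
      rw [hH]
      simp only [norm_div, norm_mul, Complex.norm_real, Real.norm_of_nonneg hκ.le]
      rw [div_le_iff₀ hp]
      rcases lt_or_ge ‖w - 1‖ η with h | h
      · calc κ * ‖G w‖ ≤ ‖(κ : ℂ) + 1 - w‖ * (ε / 2 * ‖(t : ℂ) + 1 - w‖) := by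
              gcongr
              · exact h1.2
              · exact (hGη w hw h).trans (by gcongr; exact h2.1)
          _ = _ := by ring
      · have hw1 : w ∈ Metric.closedBall (0 : ℂ) 1 := by simp [hw]
        have hκη : κ * C ≤ ε / 2 * η := by
          rw [hκdef, div_mul_eq_mul_div, div_le_iff₀ (by positivity)]
          nlinarith [mul_pos hη hε]
        calc κ * ‖G w‖ ≤ κ * (C * ‖w - 1‖) := by gcongr; exact hGC w hw1
          _ = (κ * C) * ‖w - 1‖ := by ring
          _ ≤ (ε / 2 * η) * ‖w - 1‖ := by gcongr
          _ = ε / 2 * (η * ‖w - 1‖) := by ring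
          _ ≤ ε / 2 * (‖(κ : ℂ) + 1 - w‖ * ‖(t : ℂ) + 1 - w‖) := by
              gcongr
              · exact h.trans h1.1
              · exact h2.1
    have hz' : z ∈ closure (Metric.ball (0 : ℂ) 1) := subset_closure (by simpa using hz)
    have := Complex.norm_le_of_forall_mem_frontier_norm_le Metric.isBounded_ball hHd hbd hz'
    have h1 := hden z hz.le κ hκ.le
    have h2 := hden z hz.le t ht.le
    have hp : 0 < ‖(κ : ℂ) + 1 - z‖ * ‖(t : ℂ) + 1 - z‖ :=
      mul_pos (hκ.trans_le h1.2) (ht.trans_le h2.2)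
    rw [hH] at this
    simp only [norm_div, norm_mul, Complex.norm_real, Real.norm_of_nonneg hκ.le] at this
    rwa [div_le_iff₀ hp] at this
  refine ⟨κ, hκ, fun z hz hzκ => ?_⟩
  have hlim : κ * ‖G z‖ ≤ ε / 2 * (‖(κ : ℂ) + 1 - z‖ * ‖((0 : ℝ) : ℂ) + 1 - z‖) := by
    have hcont : Continuous fun t : ℝ => ε / 2 * (‖(κ : ℂ) + 1 - z‖ * ‖(t : ℂ) + 1 - z‖) := by
      fun_prop
    refine ge_of_tendsto ((hcont.tendsto 0).mono_left (nhdsWithin_le_nhds (s := Set.Ioi 0))) ?_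
    filter_upwards [self_mem_nhdsWithin] with t ht using hκG z hz t ht
  have hle : ‖(κ : ℂ) + 1 - z‖ ≤ 2 * κ := by
    calc ‖(κ : ℂ) + 1 - z‖ = ‖(κ : ℂ) - (z - 1)‖ := by congr 1; ring
      _ ≤ ‖(κ : ℂ)‖ + ‖z - 1‖ := norm_sub_le _ _
      _ ≤ 2 * κ := by rw [Complex.norm_real, Real.norm_of_nonneg hκ.le]; linarith
  have hz1 : ‖((0 : ℝ) : ℂ) + 1 - z‖ = ‖z - 1‖ := by
    rw [norm_sub_rev z 1]; simp
  rw [hz1] at hlim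
  have : κ * ‖G z‖ ≤ κ * (ε * ‖z - 1‖) := by
    calc κ * ‖G z‖ ≤ ε / 2 * (‖(κ : ℂ) + 1 - z‖ * ‖z - 1‖) := hlim
      _ ≤ ε / 2 * (2 * κ * ‖z - 1‖) := by gcongr
      _ = _ := by ring
  exact le_of_mul_le_mul_left this hκ

/-- Cauchy's estimate on the disc of radius `(1 - r) / 2` about `r`, where `|z - 1|` is comparable
to the radius. -/
lemma tendsto_deriv_of_isLittleO {G : ℂ → ℂ} (hGd : DifferentiableOn ℂ G (Metric.ball 0 1))
    (hGo : ∀ ε > 0, ∃ κ > 0, ∀ z : ℂ, ‖z‖ < 1 → ‖z - 1‖ < κ → ‖G z‖ ≤ ε * ‖z - 1‖) :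
    Tendsto (fun r : ℝ => deriv G r) (𝓝[<] 1) (𝓝 0) := by
  rw [Metric.tendsto_nhds]
  intro ε hε
  obtain ⟨κ, hκ, h⟩ := hGo (ε / 4) (by positivity)
  have h0 : ∀ᶠ r : ℝ in 𝓝[<] 1, max 0 (1 - κ / 2) < r :=
    nhdsWithin_le_nhds (lt_mem_nhds (by simp [hκ]))
  filter_upwards [h0, self_mem_nhdsWithin] with r hr hr1
  obtain ⟨hr0, hrκ⟩ := max_lt_iff.1 hr
  have hr1 : r < 1 := hr1
  have hs : ∀ z ∈ Metric.closedBall (r : ℂ) ((1 - r) / 2), ‖z‖ < 1 ∧ ‖z - 1‖ ≤ 3 / 2 * (1 - r) := by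
    intro z hz
    rw [mem_closedBall_iff_norm] at hz
    have hrn : ‖(r : ℂ)‖ = r := by simp [abs_of_pos hr0]
    have hrn1 : ‖(r : ℂ) - 1‖ = 1 - r := by
      rw [← Complex.ofReal_one, ← Complex.ofReal_sub, Complex.norm_real, Real.norm_eq_abs,
        abs_sub_comm, abs_of_pos (by linarith)]
    constructor
    · have := norm_add_le (z - r) (r : ℂ)
      rw [sub_add_cancel] at this
      linarith
    · have := norm_add_le (z - r) ((r : ℂ) - 1)
      rw [sub_add_sub_cancel] at this
      linarith
  have hd : DiffContOnCl ℂ G (Metric.ball (r : ℂ) ((1 - r) / 2)) := by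
    apply (hGd.mono _).diffContOnCl_ball subset_rfl
    intro z hz
    simpa using (hs z hz).1
  have := Complex.norm_deriv_le_of_forall_mem_sphere_norm_le (by linarith : 0 < (1 - r) / 2) hd
    (C := ε / 4 * (3 / 2 * (1 - r))) (by
      intro z hz
      obtain ⟨h1, h2⟩ := hs z (Metric.sphere_subset_closedBall hz)
      exact (h z h1 (by linarith)).trans (by gcongr))
  rw [dist_zero_right]
  refine this.trans_lt ?_
  rw [div_lt_iff₀ (by linarith)]
  nlinarith

lemma abs_arg_le_pi_div_two_mul_norm_sub_one {ζ : ℂ} (hζ : ‖ζ‖ = 1) :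
    |ζ.arg| ≤ Real.pi / 2 * ‖ζ - 1‖ := by
  have h : ζ = Complex.exp (Complex.I * ζ.arg) := by
    have := Complex.norm_mul_exp_arg_mul_I ζ
    rw [hζ] at this
    rw [mul_comm Complex.I]
    simpa using this.symm
  have h2 : ‖ζ - 1‖ = ‖2 * Real.sin (ζ.arg / 2)‖ := by
    conv_lhs => rw [h]
    exact Complex.norm_exp_I_mul_ofReal_sub_one _
  rw [h2, norm_mul, Real.norm_eq_abs, Real.norm_eq_abs, abs_two]
  have h3 : |ζ.arg / 2| ≤ Real.pi / 2 := by
    rw [abs_div, abs_two]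
    gcongr
    exact Complex.abs_arg_le_pi ζ
  have h4 := Real.mul_abs_le_abs_sin h3
  rw [abs_div, abs_two] at h4
  have hpi := Real.pi_pos
  rw [div_mul_eq_mul_div, div_le_iff₀ hpi] at h4
  nlinarith

/-- **Fatou's theorem** for bounded holomorphic functions on the unit disc. -/
theorem ae_exists_tendsto_radial {g : ℂ → ℂ} {M : ℝ}
    (hg : DifferentiableOn ℂ g (Metric.ball 0 1)) (hgM : ∀ z ∈ Metric.ball (0 : ℂ) 1, ‖g z‖ ≤ M) :
    ∀ᵐ t : ℝ, ∃ L : ℂ,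
      Tendsto (fun r : ℝ => g (r * Complex.exp (t * Complex.I))) (𝓝[<] 1) (𝓝 L) := by
  have hM : 0 ≤ M := (norm_nonneg _).trans (hgM 0 (by simp))
  obtain ⟨F₀, hF₀⟩ := hg.isExactOn_ball
  have hLip : LipschitzOnWith M.toNNReal F₀ (Metric.ball 0 1) := by
    apply (convex_ball (0 : ℂ) 1).lipschitzOnWith_of_nnnorm_hasDerivWithin_le
      (f' := g) (fun z hz => (hF₀ z hz).hasDerivWithinAt)
    intro z hz
    rw [← NNReal.coe_le_coe, coe_nnnorm, Real.coe_toNNReal _ hM]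
    exact hgM z hz
  -- The Lipschitz extension supplies the boundary values of the primitive.
  obtain ⟨F, hF, hFF₀⟩ := hLip.extend_finite_dimension
  have hFd : ∀ z ∈ Metric.ball (0 : ℂ) 1, HasDerivAt F (g z) z := by
    intro z hz
    apply (hF₀ z hz).congr_of_eventuallyEq
    filter_upwards [Metric.isOpen_ball.mem_nhds hz] with w hw using (hFF₀ hw).symm
  set K := lipschitzExtensionConstant ℂ * M.toNNReal
  have hhL : LipschitzWith (K * 1) (fun t : ℝ => F (Complex.exp (t * Complex.I))) := by
    apply hF.comp
    apply lipschitzWith_of_nnnorm_deriv_le (𝕜 := ℝ) (by fun_prop)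
    intro t
    have : HasDerivAt (fun t : ℝ => Complex.exp (t * Complex.I))
        (Complex.exp (t * Complex.I) * (1 * Complex.I)) t :=
      ((Complex.ofRealCLM.hasDerivAt (x := t)).mul_const Complex.I).cexp
    rw [this.deriv, ← NNReal.coe_le_coe, coe_nnnorm]
    simp [Complex.norm_exp_ofReal_mul_I]
  filter_upwards [hhL.ae_differentiableAt_real] with t ht
  set h' := deriv (fun t : ℝ => F (Complex.exp (t * Complex.I))) t
  have hh' : HasDerivAt (fun t : ℝ => F (Complex.exp (t * Complex.I))) h' t := ht.hasDerivAt
  set ζ := Complex.exp (t * Complex.I) with hζ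
  have hζn : ‖ζ‖ = 1 := Complex.norm_exp_ofReal_mul_I t
  -- Slope of `w ↦ F (ζ * w)` at 1 along the circle, since `exp (i s)` has derivative `i` at 0.
  -- Subtracting it makes `G` little-o there, while `G' = ζ * g (ζ * z) - B` inside.
  set B := h' / Complex.I with hB
  set G : ℂ → ℂ := fun z => F (ζ * z) - F ζ - B * (z - 1) with hG
  have hball : ∀ z ∈ Metric.ball (0 : ℂ) 1, ζ * z ∈ Metric.ball (0 : ℂ) 1 := by
    intro z hz
    simpa [hζn] using hz
  have hGd' : ∀ z ∈ Metric.ball (0 : ℂ) 1, HasDerivAt G (ζ * g (ζ * z) - B) z := by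
    intro z hz
    have h1 := (hFd _ (hball z hz)).comp z ((hasDerivAt_id z).const_mul ζ)
    have h2 := ((h1.sub_const (F ζ)).sub (((hasDerivAt_id z).sub_const 1).const_mul B))
    exact h2.congr_deriv (by simp; ring)
  have hGd : DifferentiableOn ℂ G (Metric.ball 0 1) := fun z hz =>
    (hGd' z hz).differentiableAt.differentiableWithinAt
  have hGc : Continuous G := by
    have := hF.continuous
    fun_prop
  have hGC : ∀ z ∈ Metric.closedBall (0 : ℂ) 1, ‖G z‖ ≤ (K + ‖B‖) * ‖z - 1‖ := by
    intro z _
    have h1 : ‖F (ζ * z) - F ζ‖ ≤ K * ‖z - 1‖ := by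
      have := hF.norm_sub_le (ζ * z) ζ
      rwa [show ζ * z - ζ = ζ * (z - 1) by ring, norm_mul, hζn, one_mul] at this
    calc ‖G z‖ ≤ ‖F (ζ * z) - F ζ‖ + ‖B * (z - 1)‖ := norm_sub_le _ _
      _ ≤ K * ‖z - 1‖ + ‖B‖ * ‖z - 1‖ := by rw [norm_mul]; gcongr
      _ = _ := by ring
  have hGo : ∀ ε > 0, ∃ η > 0, ∀ w : ℂ, ‖w‖ = 1 → ‖w - 1‖ < η → ‖G w‖ ≤ ε * ‖w - 1‖ := by
    intro ε hε
    have hlo := hasDerivAt_iff_isLittleO_nhds_zero.1 hh'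
    have hε' : 0 < ε / 4 := by positivity
    obtain ⟨δ, hδ, hδs⟩ := Metric.eventually_nhds_iff.1 (hlo.def hε')
    -- The three bounds serve differentiability of the boundary function, the second-order estimate
    -- of `exp`, and the absorption of `‖B‖ * |s| ^ 2`.
    set s₀ := min δ (min 1 (ε / (4 * (‖B‖ + 1))))
    have hs₀ : 0 < s₀ := by positivity
    have hpi := Real.pi_pos
    refine ⟨s₀ / 2, by positivity, fun w hw hwη => ?_⟩
    set s := w.arg
    have hs1 : |s| ≤ 2 * ‖w - 1‖ :=
      (abs_arg_le_pi_div_two_mul_norm_sub_one hw).trans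
        (by gcongr; linarith [Real.pi_le_four])
    have hs2 : |s| < s₀ := by linarith
    have hsδ : |s| < δ := hs2.trans_le (min_le_left _ _)
    have hs11 : |s| ≤ 1 := hs2.le.trans ((min_le_right _ _).trans (min_le_left _ _))
    have hsB : |s| ≤ ε / (4 * (‖B‖ + 1)) :=
      hs2.le.trans ((min_le_right _ _).trans (min_le_right _ _))
    have hwe : w = Complex.exp (s * Complex.I) := by
      have := Complex.norm_mul_exp_arg_mul_I w
      rw [hw] at this
      simpa using this.symm
    have e1 : ‖F (ζ * w) - F ζ - (s : ℂ) * h'‖ ≤ ε / 4 * |s| := by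
      have := hδs (y := s) (by simpa using hsδ)
      rw [Real.norm_eq_abs, Complex.real_smul] at this
      have hζw : ζ * w = Complex.exp ((t + s : ℝ) * Complex.I) := by
        rw [hζ, hwe, ← Complex.exp_add]
        push_cast
        ring_nf
      rwa [hζw]
    have e2 : ‖w - 1 - s * Complex.I‖ ≤ |s| ^ 2 := by
      have := Complex.norm_exp_sub_one_sub_id_le (x := s * Complex.I) (by simpa using hs11)
      rw [← hwe] at this
      simpa using this
    have e3 : G w = (F (ζ * w) - F ζ - (s : ℂ) * h') - B * (w - 1 - s * Complex.I) := by
      have : B * Complex.I = h' := by rw [hB, div_mul_cancel₀ _ Complex.I_ne_zero]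
      rw [hG, ← this]
      ring
    have e4 : ‖B‖ * |s| ≤ ε / 4 := by
      have := mul_le_mul_of_nonneg_left hsB (norm_nonneg B)
      refine this.trans ?_
      rw [mul_div_assoc', div_le_div_iff₀ (by positivity) (by norm_num)]
      nlinarith [norm_nonneg B]
    calc ‖G w‖ ≤ ‖F (ζ * w) - F ζ - (s : ℂ) * h'‖ + ‖B * (w - 1 - s * Complex.I)‖ := by
          rw [e3]; exact norm_sub_le _ _
      _ ≤ ε / 4 * |s| + ‖B‖ * |s| ^ 2 := by rw [norm_mul]; gcongr
      _ = (ε / 4 + ‖B‖ * |s|) * |s| := by ring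
      _ ≤ (ε / 4 + ε / 4) * (2 * ‖w - 1‖) := by gcongr
      _ = ε * ‖w - 1‖ := by ring
  have hlim := tendsto_deriv_of_isLittleO hGd fun ε hε =>
    norm_le_mul_sub_one_of_isLittleO_circle hGc.continuousOn hGd hGC hGo hε
  refine ⟨B / ζ, ?_⟩
  have hζ0 : ζ ≠ 0 := by rw [hζ]; exact Complex.exp_ne_zero _
  have hlim2 : Tendsto (fun r : ℝ => (deriv G r + B) / ζ) (𝓝[<] 1) (𝓝 ((0 + B) / ζ)) :=
    (hlim.add_const B).div_const ζ
  rw [zero_add] at hlim2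
  refine hlim2.congr' ?_
  have h0 : ∀ᶠ r : ℝ in 𝓝[<] 1, 0 < r := nhdsWithin_le_nhds (lt_mem_nhds one_pos)
  filter_upwards [h0, self_mem_nhdsWithin] with r hr0 hr1
  have hr : (r : ℂ) ∈ Metric.ball (0 : ℂ) 1 := by
    simpa [abs_of_pos hr0] using hr1
  rw [(hGd' r hr).deriv, sub_add_cancel, mul_div_cancel_left₀ _ hζ0, mul_comm]

/-! ### Caps, tents and boxes; doubling of the surface measure. -/

/-- The unit sphere of `ℂⁿ`. -/
abbrev UnitSphere (n : ℕ) : Type := Metric.sphere (0 : EuclideanSpace ℂ (Fin n)) 1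

/-- The closed nonisotropic cap `{ω ∈ ∂B : |1 - ω · P̄| ≤ s}`. -/
def cap {n : ℕ} (P : UnitSphere n) (s : ℝ) : Set (UnitSphere n) :=
  {ω | ‖1 - inner ℂ (P : EuclideanSpace ℂ (Fin n)) (ω : EuclideanSpace ℂ (Fin n))‖ ≤ s}

/-- The Carleson tent `{z ∈ B : |1 - z · P̄| < s}`. -/
def tent {n : ℕ} (P : EuclideanSpace ℂ (Fin n)) (s : ℝ) : Set (EuclideanSpace ℂ (Fin n)) :=
  {z | ‖z‖ < 1 ∧ ‖1 - inner ℂ P z‖ < s}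

/-- The nonisotropic box of size `a` in the complex normal direction `P` and of size `b` in the
complex tangential directions. -/
def box {n : ℕ} (P : EuclideanSpace ℂ (Fin n)) (a b : ℝ) : Set (EuclideanSpace ℂ (Fin n)) :=
  {v | ‖inner ℂ P v‖ < a ∧ ‖v‖ < b}

/-- The radii in `(1 - h, 1)`. -/
def shellRadii (h : ℝ) : Set (Set.Ioi (0 : ℝ)) := {r | 1 - h < r.1 ∧ r.1 < 1}

/-- The part over `S ⊆ ∂B` of the spherical shell `{1 - h < |z| < 1}`. -/
def shell {n : ℕ} (S : Set (UnitSphere n)) (h : ℝ) : Set (EuclideanSpace ℂ (Fin n)) :=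
  Subtype.val '' (homeomorphUnitSphereProd (EuclideanSpace ℂ (Fin n)) ⁻¹' (S ×ˢ shellRadii h))

section Shell

variable {n : ℕ}

instance : IsFiniteMeasure (sphereArea n) := by unfold sphereArea; infer_instance

lemma mem_shell {S : Set (UnitSphere n)} {h : ℝ} {z : EuclideanSpace ℂ (Fin n)} :
    z ∈ shell S h ↔ ∃ ω ∈ S, ∃ r : ℝ, 0 < r ∧ 1 - h < r ∧ r < 1 ∧
      z = (r : ℂ) • (ω : EuclideanSpace ℂ (Fin n)) := by
  rw [shell, ← Homeomorph.image_symm, Set.image_image]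
  constructor
  · rintro ⟨⟨ω, r⟩, ⟨hω, hr⟩, rfl⟩
    exact ⟨ω, hω, r.1, r.2, hr.1, hr.2, by simp [Complex.coe_smul]⟩
  · rintro ⟨ω, hω, r, hr0, hr1, hr2, rfl⟩
    exact ⟨⟨ω, ⟨r, hr0⟩⟩, ⟨hω, hr1, hr2⟩, by simp [Complex.coe_smul]⟩

/-- Polar coordinates. Volume inequalities between shells of equal thickness become inequalities for
σ once the common radial factor is cancelled. -/
lemma volume_shell (S : Set (UnitSphere n)) (h : ℝ) :
    volume (shell S h) = sphereArea n S *
      Measure.volumeIoiPow (Module.finrank ℝ (EuclideanSpace ℂ (Fin n)) - 1) (shellRadii h) := by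
  have hmp := (volume : Measure (EuclideanSpace ℂ (Fin n))).measurePreserving_homeomorphUnitSphereProd
  have hemb : MeasurableEmbedding
      (Subtype.val : ({0}ᶜ : Set (EuclideanSpace ℂ (Fin n))) → EuclideanSpace ℂ (Fin n)) :=
    MeasurableEmbedding.subtype_coe (measurableSet_singleton _).compl
  rw [shell, ← hemb.comap_apply, hmp.measure_preimage_emb (Homeomorph.measurableEmbedding _),
    Measure.prod_prod]
  rfl

lemma measurableSet_shell {S : Set (UnitSphere n)} (hS : MeasurableSet S) (h : ℝ) :
    MeasurableSet (shell S h) := by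
  refine (MeasurableEmbedding.subtype_coe (measurableSet_singleton _).compl).measurableSet_image' ?_
  refine (Homeomorph.measurableEmbedding _).measurable (hS.prod ?_)
  exact (measurableSet_lt measurable_const measurable_subtype_coe).inter
    (measurableSet_lt measurable_subtype_coe measurable_const)

lemma shell_cap_subset_tent (P : UnitSphere n) (a h : ℝ) :
    shell (cap P a) h ⊆ tent (P : EuclideanSpace ℂ (Fin n)) (a + h) := by
  intro z hz
  obtain ⟨ω, hω, r, hr0, hr1, hr2, rfl⟩ := mem_shell.1 hz
  have hω1 : ‖(ω : EuclideanSpace ℂ (Fin n))‖ = 1 := norm_eq_of_mem_sphere ω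
  have hP1 : ‖(P : EuclideanSpace ℂ (Fin n))‖ = 1 := norm_eq_of_mem_sphere P
  have hω : ‖1 - inner ℂ (P : EuclideanSpace ℂ (Fin n)) (ω : EuclideanSpace ℂ (Fin n))‖ ≤ a := hω
  have hx := norm_inner_le_norm (𝕜 := ℂ) (P : EuclideanSpace ℂ (Fin n)) (ω : EuclideanSpace ℂ (Fin n))
  set x := inner ℂ (P : EuclideanSpace ℂ (Fin n)) (ω : EuclideanSpace ℂ (Fin n))
  rw [hω1, hP1, one_mul] at hx
  constructor
  · rw [norm_smul, hω1, Complex.norm_real, Real.norm_of_nonneg hr0.le]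
    linarith
  · rw [inner_smul_right]
    have e : 1 - (r : ℂ) * x = (1 - x) + ((1 - r : ℝ) : ℂ) * x := by push_cast; ring
    rw [e]
    refine (norm_add_le _ _).trans_lt ?_
    rw [norm_mul, Complex.norm_real, Real.norm_of_nonneg (by linarith)]
    nlinarith

lemma one_sub_norm_lt_of_mem_tent {P z : EuclideanSpace ℂ (Fin n)} (hP : ‖P‖ = 1) {h : ℝ}
    (hz : z ∈ tent P h) : 1 - ‖z‖ < h := by
  have hx := norm_inner_le_norm (𝕜 := ℂ) P z
  rw [hP, one_mul] at hx
  have := norm_sub_norm_le (1 : ℂ) (inner ℂ P z)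
  rw [norm_one] at this
  linarith [hz.2]

/-- Projecting `z` to the sphere moves `z · P̄` by at most `1 - |z| < h`, hence the aperture `2 *
h`; `h ≤ 1` keeps `z` away from 0. -/
lemma exists_polar_of_mem_tent {P : UnitSphere n} {h : ℝ} (hh : h ≤ 1)
    {z : EuclideanSpace ℂ (Fin n)} (hz : z ∈ tent (P : EuclideanSpace ℂ (Fin n)) h) :
    ∃ ω ∈ cap P (2 * h), ∃ r : ℝ, 0 < r ∧ 1 - h < r ∧ r < 1 ∧
      z = (r : ℂ) • (ω : EuclideanSpace ℂ (Fin n)) := by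
  have hP1 : ‖(P : EuclideanSpace ℂ (Fin n))‖ = 1 := norm_eq_of_mem_sphere P
  have hr1 := one_sub_norm_lt_of_mem_tent hP1 hz
  have hr0 : 0 < ‖z‖ := by linarith
  have hr0' : (‖z‖ : ℂ) ≠ 0 := by exact_mod_cast hr0.ne'
  have hω1 : ‖(‖z‖ : ℂ)⁻¹ • z‖ = 1 := by
    rw [norm_smul, norm_inv, Complex.norm_real, norm_norm, inv_mul_cancel₀ hr0.ne']
  refine ⟨⟨(‖z‖ : ℂ)⁻¹ • z, by simpa using hω1⟩, ?_, ‖z‖, hr0, by linarith, hz.1, ?_⟩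
  · change ‖1 - inner ℂ (P : EuclideanSpace ℂ (Fin n)) ((‖z‖ : ℂ)⁻¹ • z)‖ ≤ 2 * h
    have hx := norm_inner_le_norm (𝕜 := ℂ) (P : EuclideanSpace ℂ (Fin n)) ((‖z‖ : ℂ)⁻¹ • z)
    rw [hP1, hω1, one_mul] at hx
    have hz2 := hz.2
    have hzz : z = (‖z‖ : ℂ) • ((‖z‖ : ℂ)⁻¹ • z) := by rw [smul_inv_smul₀ hr0']
    rw [hzz, inner_smul_right] at hz2
    set x := inner ℂ (P : EuclideanSpace ℂ (Fin n)) ((‖z‖ : ℂ)⁻¹ • z)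
    have e : 1 - x = (1 - (‖z‖ : ℂ) * x) - ((1 - ‖z‖ : ℝ) : ℂ) * x := by push_cast; ring
    rw [e]
    refine (norm_sub_le _ _).trans ?_
    rw [norm_mul, Complex.norm_real, Real.norm_of_nonneg (by linarith [hz.1])]
    nlinarith [hz.1]
  · simp [smul_inv_smul₀ hr0']

lemma tent_subset_shell_cap (P : UnitSphere n) {h : ℝ} (hh : h ≤ 1) :
    tent (P : EuclideanSpace ℂ (Fin n)) h ⊆ shell (cap P (2 * h)) h := fun _ hz =>
  mem_shell.2 (exists_polar_of_mem_tent hh hz)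

lemma isOpen_box (P : EuclideanSpace ℂ (Fin n)) (a b : ℝ) : IsOpen (box P a b) := by
  refine IsOpen.inter (s := {v | ‖inner ℂ P v‖ < a}) (t := {v | ‖v‖ < b}) ?_ ?_
  · exact isOpen_lt (by fun_prop) continuous_const
  · exact isOpen_lt (by fun_prop) continuous_const

lemma isOpen_tent (P : EuclideanSpace ℂ (Fin n)) (a : ℝ) : IsOpen (tent P a) := by
  refine IsOpen.inter (s := {z | ‖z‖ < 1}) (t := {z | ‖1 - inner ℂ P z‖ < a}) ?_ ?_
  · exact isOpen_lt (by fun_prop) continuous_const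
  · exact isOpen_lt (by fun_prop) continuous_const

lemma isClosed_cap (P : UnitSphere n) (a : ℝ) : IsClosed (cap P a) :=
  isClosed_le (by fun_prop) continuous_const

/-- The nonisotropic dilation by `δ` along `P` and by `t` (with `t ^ 2 = δ`) in the tangential
directions. -/
noncomputable def anisotropicDilation (P : EuclideanSpace ℂ (Fin n)) (δ t : ℝ) :
    EuclideanSpace ℂ (Fin n) →ₗ[ℝ] EuclideanSpace ℂ (Fin n) :=
  ((t : ℂ) • LinearMap.id +
    ((δ : ℂ) - t) • ((innerSL ℂ P).toLinearMap.smulRight P)).restrictScalars ℝ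

lemma anisotropicDilation_apply (P v : EuclideanSpace ℂ (Fin n)) (δ t : ℝ) :
    anisotropicDilation P δ t v = (t : ℂ) • v + ((δ : ℂ) - t) • (inner ℂ P v • P) := by
  simp [anisotropicDilation]

lemma box_subset_image (P : EuclideanSpace ℂ (Fin n)) (hP : ‖P‖ = 1) {t A B : ℝ} (ht : 0 < t)
    (ht1 : t ≤ 1) :
    box P (A * t ^ 2) (B * t) ⊆ anisotropicDilation P (t ^ 2) t '' Metric.ball 0 (A + B) := by
  intro v hv
  have htc : (t : ℂ) ≠ 0 := by exact_mod_cast ht.ne'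
  have hPP : inner ℂ P P = 1 := by rw [inner_self_eq_norm_sq_to_K, hP]; simp
  -- The inverse dilation: `t⁻¹` tangentially, `t⁻²` along `P`.
  refine ⟨(t : ℂ)⁻¹ • v + (((t : ℂ) ^ 2)⁻¹ - (t : ℂ)⁻¹) • (inner ℂ P v • P), ?_, ?_⟩
  · rw [mem_ball_zero_iff]
    refine (norm_add_le _ _).trans_lt ?_
    have h1 : ‖(t : ℂ)⁻¹ • v‖ < B := by
      rw [norm_smul, norm_inv, Complex.norm_real, Real.norm_of_nonneg ht.le,
        inv_mul_lt_iff₀ ht, mul_comm]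
      exact hv.2
    have h2 : ‖(((t : ℂ) ^ 2)⁻¹ - (t : ℂ)⁻¹) • (inner ℂ P v • P)‖ ≤ A := by
      rw [norm_smul, norm_smul, hP, mul_one]
      have e : ((t : ℂ) ^ 2)⁻¹ - (t : ℂ)⁻¹ = (((t ^ 2)⁻¹ - t⁻¹ : ℝ) : ℂ) := by push_cast; rfl
      have hle : t⁻¹ ≤ (t ^ 2)⁻¹ := inv_anti₀ (by positivity) (by nlinarith)
      rw [e, Complex.norm_real, Real.norm_of_nonneg (by linarith)]
      calc ((t ^ 2)⁻¹ - t⁻¹) * ‖inner ℂ P v‖ ≤ (t ^ 2)⁻¹ * (A * t ^ 2) := by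
            gcongr
            · have := inv_pos.2 ht; linarith
            · exact hv.1.le
        _ = A := by field_simp
    linarith
  · rw [anisotropicDilation_apply, inner_add_right, inner_smul_right, inner_smul_right,
      inner_smul_right, hPP]
    push_cast
    match_scalars
    · field_simp
    · field_simp
      ring

lemma image_ball_subset_box (P : EuclideanSpace ℂ (Fin n)) (hP : ‖P‖ = 1) {t c : ℝ} (ht : 0 < t)
    (ht1 : t ≤ 1) (hc : 0 < c) :
    anisotropicDilation P (t ^ 2) t '' Metric.ball 0 (c / 2) ⊆ box P (c * t ^ 2) (c * t) := by
  rintro _ ⟨v, hv, rfl⟩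
  rw [mem_ball_zero_iff] at hv
  have hPP : inner ℂ P P = 1 := by rw [inner_self_eq_norm_sq_to_K, hP]; simp
  have hx := norm_inner_le_norm (𝕜 := ℂ) P v
  rw [hP, one_mul] at hx
  constructor
  · rw [anisotropicDilation_apply, inner_add_right, inner_smul_right, inner_smul_right,
      inner_smul_right, hPP]
    have e : (t : ℂ) * inner ℂ P v + (((t ^ 2 : ℝ) : ℂ) - t) * (inner ℂ P v * 1) =
        ((t ^ 2 : ℝ) : ℂ) * inner ℂ P v := by ring
    rw [e, norm_mul, Complex.norm_real, Real.norm_of_nonneg (by positivity), mul_comm c]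
    gcongr
    linarith
  · rw [anisotropicDilation_apply]
    refine (norm_add_le _ _).trans_lt ?_
    rw [norm_smul, norm_smul, norm_smul, hP, ← Complex.ofReal_sub, Complex.norm_real,
      Complex.norm_real, Real.norm_of_nonneg ht.le, Real.norm_eq_abs, mul_one]
    have h2 : |t ^ 2 - t| ≤ t := by
      rw [abs_le]; constructor <;> nlinarith
    calc t * ‖v‖ + |t ^ 2 - t| * ‖inner ℂ P v‖ ≤ t * ‖v‖ + t * ‖v‖ := by gcongr
      _ < c * t := by nlinarith

/-- Nonisotropic boxes of comparable size have comparable volumes. -/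
lemma exists_volume_box_le (n : ℕ) (A B : ℝ) {c : ℝ} (hc : 0 < c) :
    ∃ K : ENNReal, K ≠ ⊤ ∧ ∀ (P : EuclideanSpace ℂ (Fin n)) (t : ℝ), ‖P‖ = 1 → 0 < t → t ≤ 1 →
      volume (box P (A * t ^ 2) (B * t)) ≤ K * volume (box P (c * t ^ 2) (c * t)) := by
  set b := volume (Metric.ball (0 : EuclideanSpace ℂ (Fin n)) (c / 2))
  have hb0 : b ≠ 0 := (Metric.measure_ball_pos _ _ (by positivity)).ne'
  have hbt : b ≠ ⊤ := measure_ball_lt_top.ne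
  refine ⟨volume (Metric.ball (0 : EuclideanSpace ℂ (Fin n)) (A + B)) / b,
    ENNReal.div_ne_top measure_ball_lt_top.ne hb0, fun P t hP ht ht1 => ?_⟩
  have h1 := measure_mono (μ := volume) (box_subset_image P hP (A := A) (B := B) ht ht1)
  have h2 := measure_mono (μ := volume) (image_ball_subset_box P hP ht ht1 hc)
  -- Both boxes are compared with images of fixed balls under one dilation, so its determinant
  -- cancels without being computed.
  rw [Measure.addHaar_image_linearMap] at h1 h2
  refine h1.trans ?_
  refine le_trans (le_of_eq ?_) (mul_le_mul_right h2 _)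
  rw [mul_left_comm, ENNReal.div_mul_cancel hb0 hbt]

lemma norm_sub_sq_le_of_mem_tent {P z : EuclideanSpace ℂ (Fin n)} (hP : ‖P‖ = 1) (hz : ‖z‖ ≤ 1) :
    ‖z - P‖ ^ 2 ≤ 2 * ‖1 - inner ℂ P z‖ := by
  have h1 := @norm_sub_sq ℂ _ _ _ _ P z
  rw [norm_sub_rev z P, h1, hP]
  have h2 := Complex.re_le_norm (1 - inner ℂ P z)
  simp only [Complex.sub_re, Complex.one_re] at h2
  simp only [RCLike.re_to_complex]
  nlinarith [norm_nonneg z]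

lemma exists_volume_tent_le_box (n : ℕ) (k : ℝ) {c : ℝ} (hk : 0 < k) (hc : 0 < c) :
    ∃ K : ENNReal, K ≠ ⊤ ∧ ∀ (P : EuclideanSpace ℂ (Fin n)) (t : ℝ), ‖P‖ = 1 → 0 < t → t ≤ 1 →
      volume (tent P (k * t ^ 2)) ≤ K * volume (box P (c * t ^ 2) (c * t)) := by
  obtain ⟨K, hK, h⟩ := exists_volume_box_le n k (2 * √k) hc
  refine ⟨K, hK, fun P t hP ht ht1 => le_trans ?_ (h P t hP ht ht1)⟩
  rw [← measure_preimage_add_right volume (-P) (box P _ _)]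
  apply measure_mono
  intro z hz
  have hn := norm_sub_sq_le_of_mem_tent hP hz.1.le
  have hPP : inner ℂ P P = 1 := by rw [inner_self_eq_norm_sq_to_K, hP]; simp
  constructor
  · change ‖inner ℂ P (z + -P)‖ < _
    rw [← sub_eq_add_neg, inner_sub_right, hPP, norm_sub_rev]
    exact hz.2
  · change ‖z + -P‖ < _
    rw [← sub_eq_add_neg]
    apply lt_of_pow_lt_pow_left₀ 2 (by positivity)
    rw [mul_pow, mul_pow, Real.sq_sqrt hk.le]
    have := hz.2
    nlinarith [mul_pos hk (pow_pos ht 2)]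

/-- The box is translated to `(1 - t ^ 2 / 2) P`, halfway into the tent; the constant `1 / 8` leaves
room for `|z| < 1`. -/
lemma volume_box_le_tent {P : EuclideanSpace ℂ (Fin n)} (hP : ‖P‖ = 1) {t : ℝ} (ht : 0 < t)
    (ht1 : t ≤ 1) :
    volume (box P (1 / 8 * t ^ 2) (1 / 8 * t)) ≤ volume (tent P (t ^ 2)) := by
  have hPP : inner ℂ P P = 1 := by rw [inner_self_eq_norm_sq_to_K, hP]; simp
  rw [← measure_preimage_add_right volume (((1 - t ^ 2 / 2 : ℝ) : ℂ) • P) (tent P _)]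
  apply measure_mono
  intro v hv
  have ht2 : 0 < t ^ 2 := by positivity
  have ht21 : t ^ 2 ≤ 1 := by nlinarith
  constructor
  · apply lt_of_pow_lt_pow_left₀ 2 (by norm_num)
    rw [@norm_add_sq ℂ, norm_smul, hP, Complex.norm_real, Real.norm_of_nonneg (by linarith),
      ← inner_conj_symm, inner_smul_left]
    simp only [RCLike.re_to_complex, Complex.conj_re, Complex.conj_ofReal, Complex.re_ofReal_mul]
    have h1 : (inner ℂ P v).re ≤ 1 / 8 * t ^ 2 := (Complex.re_le_norm _).trans hv.1.le
    have h2 : ‖v‖ ^ 2 ≤ (1 / 8 * t) ^ 2 := by gcongr; exact hv.2.le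
    nlinarith
  · rw [inner_add_right, inner_smul_right, hPP]
    have e : 1 - (inner ℂ P v + ((1 - t ^ 2 / 2 : ℝ) : ℂ) * 1) =
        ((t ^ 2 / 2 : ℝ) : ℂ) - inner ℂ P v := by push_cast; ring
    rw [e]
    refine (norm_sub_le _ _).trans_lt ?_
    rw [Complex.norm_real, Real.norm_of_nonneg (by positivity)]
    linarith [hv.1]

lemma volume_shellRadii_ne_top (m : ℕ) (h : ℝ) : Measure.volumeIoiPow m (shellRadii h) ≠ ⊤ := by
  refine ne_top_of_le_ne_top ?_ (measure_mono (t := Set.Iio ⟨1, Set.mem_Ioi.2 one_pos⟩) ?_)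
  · rw [Measure.volumeIoiPow_apply_Iio]; exact ENNReal.ofReal_ne_top
  · intro r hr; exact hr.2

lemma volume_tent_pos {P : EuclideanSpace ℂ (Fin n)} (hP : ‖P‖ = 1) {h : ℝ} (hh : 0 < h)
    (hh1 : h ≤ 1) : 0 < volume (tent P h) := by
  have hPP : inner ℂ P P = 1 := by rw [inner_self_eq_norm_sq_to_K, hP]; simp
  refine (isOpen_tent P h).measure_pos _ ⟨((1 - h / 2 : ℝ) : ℂ) • P, ?_, ?_⟩
  · rw [norm_smul, hP, Complex.norm_real, Real.norm_of_nonneg (by linarith)]; linarith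
  · rw [inner_smul_right, hPP, mul_one, ← Complex.ofReal_one, ← Complex.ofReal_sub,
      Complex.norm_real, Real.norm_of_nonneg (by linarith)]
    linarith

/-- Otherwise the nonempty open tent at `P` would be null. -/
lemma volume_shellRadii_ne_zero (P : UnitSphere n) {h : ℝ} (hh : 0 < h) (hh1 : h ≤ 1) :
    Measure.volumeIoiPow (Module.finrank ℝ (EuclideanSpace ℂ (Fin n)) - 1) (shellRadii h) ≠ 0 := by
  intro h0
  have h1 := measure_mono (μ := volume) (tent_subset_shell_cap P hh1)
  rw [volume_shell, h0, mul_zero] at h1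
  exact (volume_tent_pos (norm_eq_of_mem_sphere P) hh hh1).ne' (le_antisymm h1 bot_le)

/-- With thickness `s / 2 = t ^ 2`, the shell over the large cap lies in a tent of size `9 * t ^ 2`,
and the shell over the small cap contains the tent of size `t ^ 2`; a box compares the two tents. -/
lemma exists_sphereArea_cap_le (n : ℕ) : ∃ K : ENNReal, K ≠ ⊤ ∧
    ∀ (P : UnitSphere n) (s : ℝ), 0 < s → s ≤ 1 →
      sphereArea n (cap P (4 * s)) ≤ K * sphereArea n (cap P s) := by
  obtain ⟨K, hK, h⟩ := exists_volume_tent_le_box n (k := 9) (c := 1 / 8) (by norm_num) (by norm_num)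
  refine ⟨K, hK, fun P s hs hs1 => ?_⟩
  have hP : ‖(P : EuclideanSpace ℂ (Fin n))‖ = 1 := norm_eq_of_mem_sphere P
  set t := √(s / 2)
  have ht2 : t ^ 2 = s / 2 := Real.sq_sqrt (by positivity)
  have ht : 0 < t := Real.sqrt_pos.2 (by positivity)
  have ht1 : t ≤ 1 := by nlinarith
  set v := Measure.volumeIoiPow (Module.finrank ℝ (EuclideanSpace ℂ (Fin n)) - 1)
    (shellRadii (s / 2)) with hv
  have hvt : v ≠ ⊤ := volume_shellRadii_ne_top _ _
  have key : sphereArea n (cap P (4 * s)) * v ≤ K * sphereArea n (cap P s) * v := by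
    rw [hv, mul_assoc, ← volume_shell, ← volume_shell]
    calc volume (shell (cap P (4 * s)) (s / 2)) ≤ volume (tent (P : EuclideanSpace ℂ (Fin n)) (9 * t ^ 2)) := by
          apply measure_mono
          convert shell_cap_subset_tent P (4 * s) (s / 2) using 2
          rw [ht2]; ring
      _ ≤ K * volume (tent (P : EuclideanSpace ℂ (Fin n)) (t ^ 2)) :=
          (h P t hP ht ht1).trans (mul_le_mul_right (volume_box_le_tent hP ht ht1) _)
      _ ≤ K * volume (shell (cap P s) (s / 2)) := by
          gcongr
          rw [ht2]
          convert tent_subset_shell_cap P (h := s / 2) (by linarith) using 3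
          ring
  have hv0 : v ≠ 0 := volume_shellRadii_ne_zero P (half_pos hs) (by linarith)
  exact (ENNReal.mul_le_mul_iff_left hv0 hvt).1 key

end Shell

/-! ### Korányi's metric and Lebesgue density along caps. -/

section Metric

variable {n : ℕ}

/-- Split `a` and `b` along `c`. With `p`, `q` the square roots on the right, the parts orthogonal
to `c` have norms at most `√2 p` and `√2 q`, so `|1 - ⟨a, b⟩| ≤ p² + q² + 2pq`. -/
lemma norm_one_sub_mul_le {a b c : EuclideanSpace ℂ (Fin n)} (ha : ‖a‖ = 1) (hb : ‖b‖ = 1)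
    (hc : ‖c‖ = 1) :
    √‖1 - inner ℂ a b‖ ≤ √‖1 - inner ℂ a c‖ + √‖1 - inner ℂ c b‖ := by
  have hcc : inner ℂ c c = (1 : ℂ) := by rw [inner_self_eq_norm_sq_to_K, hc]; simp
  have hx := norm_inner_le_norm (𝕜 := ℂ) a c
  rw [ha, hc, one_mul] at hx
  have hproj : ∀ u : EuclideanSpace ℂ (Fin n), ‖u‖ = 1 →
      ‖u - inner ℂ c u • c‖ ≤ √(2 * ‖1 - inner ℂ c u‖) := by
    intro u hu
    apply Real.le_sqrt_of_sq_le
    have h1 : ‖u - inner ℂ c u • c‖ ^ 2 = 1 - ‖inner ℂ c u‖ ^ 2 := by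
      rw [@norm_sub_sq ℂ, inner_smul_right, norm_smul, hc, hu, ← inner_conj_symm u c,
        Complex.mul_conj, RCLike.re_to_complex, Complex.ofReal_re, Complex.normSq_eq_norm_sq]
      ring
    rw [h1]
    have h2 := norm_sub_norm_le (1 : ℂ) (inner ℂ c u)
    have h3 := norm_inner_le_norm (𝕜 := ℂ) c u
    rw [hc, hu] at h3
    rw [norm_one] at h2
    nlinarith [norm_nonneg (inner ℂ c u)]
  have hdec : inner ℂ a b = inner ℂ a c * inner ℂ c b +
      inner ℂ (a - inner ℂ c a • c) (b - inner ℂ c b • c) := by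
    rw [inner_sub_left, inner_sub_right, inner_sub_right, inner_smul_left, inner_smul_left,
      inner_smul_right, inner_smul_right, hcc, inner_conj_symm]
    ring
  have h1 := norm_inner_le_norm (𝕜 := ℂ) (a - inner ℂ c a • c) (b - inner ℂ c b • c)
  have h2 := mul_le_mul (hproj a ha) (hproj b hb) (norm_nonneg _) (Real.sqrt_nonneg _)
  have hsymm : ‖1 - inner ℂ c a‖ = ‖1 - inner ℂ a c‖ := by
    rw [← inner_conj_symm c a, ← Complex.norm_conj (1 - inner ℂ a c), map_sub, map_one]
  rw [hsymm, Real.sqrt_mul zero_le_two, Real.sqrt_mul zero_le_two] at h2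
  set p := √‖1 - inner ℂ a c‖ with hp
  set q := √‖1 - inner ℂ c b‖ with hq
  have hp2 : p ^ 2 = ‖1 - inner ℂ a c‖ := Real.sq_sqrt (norm_nonneg _)
  have hq2 : q ^ 2 = ‖1 - inner ℂ c b‖ := Real.sq_sqrt (norm_nonneg _)
  have hp0 : 0 ≤ p := Real.sqrt_nonneg _
  have hq0 : 0 ≤ q := Real.sqrt_nonneg _
  apply Real.sqrt_le_iff.2 ⟨by positivity, ?_⟩
  have h22 : √2 * p * (√2 * q) = 2 * (p * q) := by
    rw [mul_mul_mul_comm, Real.mul_self_sqrt zero_le_two]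
  rw [h22] at h2
  calc ‖1 - inner ℂ a b‖ = ‖(1 - inner ℂ a c) + inner ℂ a c * (1 - inner ℂ c b) -
        inner ℂ (a - inner ℂ c a • c) (b - inner ℂ c b • c)‖ := by rw [hdec]; congr 1; ring
    _ ≤ ‖1 - inner ℂ a c‖ + ‖inner ℂ a c‖ * ‖1 - inner ℂ c b‖ + 2 * (p * q) := by
        refine (norm_sub_le _ _).trans (add_le_add ((norm_add_le _ _).trans ?_) (h1.trans h2))
        rw [norm_mul]
    _ ≤ p ^ 2 + 1 * q ^ 2 + 2 * (p * q) := by rw [hp2, hq2]; gcongr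
    _ = (p + q) ^ 2 := by ring

/-- The unit sphere of `ℂⁿ` with Korányi's nonisotropic metric `|1 - ω · P̄| ^ (1 / 2)`. -/
def KoranyiSphere (n : ℕ) : Type := UnitSphere n

instance : TopologicalSpace (KoranyiSphere n) := inferInstanceAs (TopologicalSpace (UnitSphere n))

instance : MeasurableSpace (KoranyiSphere n) := inferInstanceAs (MeasurableSpace (UnitSphere n))

instance : BorelSpace (KoranyiSphere n) := inferInstanceAs (BorelSpace (UnitSphere n))

instance : SecondCountableTopology (KoranyiSphere n) :=
  inferInstanceAs (SecondCountableTopology (UnitSphere n))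

/-- The nonisotropic distance before identifying its topology with the Euclidean one. -/
@[reducible]
noncomputable def koranyiPseudoMetric (n : ℕ) : PseudoMetricSpace (KoranyiSphere n) where
  dist P ω := √‖1 - inner ℂ (P.1 : EuclideanSpace ℂ (Fin n)) ω.1‖
  dist_self P := by
    have hP : ‖(P.1 : EuclideanSpace ℂ (Fin n))‖ = 1 := norm_eq_of_mem_sphere P
    rw [inner_self_eq_norm_sq_to_K, hP]
    simp
  dist_comm P ω := by
    rw [← inner_conj_symm, ← Complex.norm_conj, map_sub, map_one, Complex.conj_conj]
  dist_triangle P ω ξ := norm_one_sub_mul_le (norm_eq_of_mem_sphere P) (norm_eq_of_mem_sphere ξ)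
    (norm_eq_of_mem_sphere ω)

lemma norm_one_sub_inner_le {P ω : EuclideanSpace ℂ (Fin n)} (hP : ‖P‖ = 1) :
    ‖1 - inner ℂ P ω‖ ≤ ‖P - ω‖ := by
  have hPP : inner ℂ P P = (1 : ℂ) := by rw [inner_self_eq_norm_sq_to_K, hP]; simp
  have := norm_inner_le_norm (𝕜 := ℂ) P (P - ω)
  rwa [inner_sub_right, hPP, hP, one_mul] at this

/-- From `|1 - ω · P̄| ≤ |P - ω|` and `|P - ω|² ≤ 2 |1 - ω · P̄|`. Thus the new metric keeps the
Borel structure. -/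
lemma koranyi_topology_eq : (inferInstance : TopologicalSpace (KoranyiSphere n)) =
    (koranyiPseudoMetric n).toUniformSpace.toTopologicalSpace := by
  refine TopologicalSpace.ext_nhds fun P => ?_
  have hP : ‖(P.1 : EuclideanSpace ℂ (Fin n))‖ = 1 := norm_eq_of_mem_sphere P
  have h1 : (@nhds (UnitSphere n) _ P).HasBasis (fun ε : ℝ => 0 < ε) (fun ε => @Metric.ball (UnitSphere n) _ P ε) :=
    Metric.nhds_basis_ball
  have h2 : (@nhds _ (koranyiPseudoMetric n).toUniformSpace.toTopologicalSpace P).HasBasis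
      (fun ε : ℝ => 0 < ε) (fun ε => @Metric.ball _ (koranyiPseudoMetric n) P ε) :=
    @Metric.nhds_basis_ball _ (koranyiPseudoMetric n) P
  refine Filter.HasBasis.ext h1 h2 ?_ ?_
  · intro ε hε
    refine ⟨ε / 2, by positivity, fun ω hω => ?_⟩
    have hω' : √‖1 - inner ℂ (ω.1 : EuclideanSpace ℂ (Fin n)) P.1‖ < ε / 2 := hω
    rw [Real.sqrt_lt' (by positivity)] at hω'
    have := norm_sub_sq_le_of_mem_tent (z := P.1) (norm_eq_of_mem_sphere ω : ‖ω.1‖ = 1) hP.le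
    change dist (ω.1 : EuclideanSpace ℂ (Fin n)) P.1 < ε
    rw [dist_eq_norm, norm_sub_rev]
    apply lt_of_pow_lt_pow_left₀ 2 hε.le
    nlinarith
  · intro ε hε
    refine ⟨ε ^ 2, by positivity, fun ω hω => ?_⟩
    have hω' : ‖(ω.1 : EuclideanSpace ℂ (Fin n)) - P.1‖ < ε ^ 2 := by
      rw [← dist_eq_norm]; exact hω
    change √‖1 - inner ℂ (ω.1 : EuclideanSpace ℂ (Fin n)) P.1‖ < ε
    rw [Real.sqrt_lt' hε]
    exact (norm_one_sub_inner_le (norm_eq_of_mem_sphere ω)).trans_lt hω'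

noncomputable instance : PseudoMetricSpace (KoranyiSphere n) :=
  (koranyiPseudoMetric n).replaceTopology koranyi_topology_eq

/-- The surface measure on the sphere with the nonisotropic metric. -/
noncomputable def koranyiArea (n : ℕ) : Measure (KoranyiSphere n) := sphereArea n

instance : IsFiniteMeasure (koranyiArea n) := inferInstanceAs (IsFiniteMeasure (sphereArea n))

lemma koranyi_closedBall (P : KoranyiSphere n) {r : ℝ} (hr : 0 ≤ r) :
    (Metric.closedBall P r : Set (KoranyiSphere n)) = cap (n := n) P (r ^ 2) := by
  ext ω
  rw [Metric.mem_closedBall, dist_comm]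
  change √‖1 - inner ℂ (P.1 : EuclideanSpace ℂ (Fin n)) ω.1‖ ≤ r ↔
    ‖1 - inner ℂ (P.1 : EuclideanSpace ℂ (Fin n)) ω.1‖ ≤ r ^ 2
  exact Real.sqrt_le_left hr

/-- Balls of radius `r` are caps of size `r ^ 2`, so doubling the radius is a factor 4 for caps. -/
instance : IsUnifLocDoublingMeasure (koranyiArea n) := by
  obtain ⟨K, hK, h⟩ := exists_sphereArea_cap_le n
  refine ⟨K.toNNReal, ?_⟩
  have h1 : ∀ᶠ ε : ℝ in 𝓝[>] 0, ε < 1 := nhdsWithin_le_nhds (gt_mem_nhds one_pos)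
  filter_upwards [h1, self_mem_nhdsWithin] with ε hε1 hε0 P
  have hε0 : 0 < ε := hε0
  rw [koranyi_closedBall P (by positivity), koranyi_closedBall P hε0.le, ENNReal.coe_toNNReal hK,
    mul_pow]
  have := h P (ε ^ 2) (by positivity) (by nlinarith)
  rwa [show (2 : ℝ) ^ 2 = 4 by norm_num]

/-- Lebesgue's density theorem for the nonisotropic caps. -/
lemma ae_eventually_sphereArea_cap_diff_le {A : Set (UnitSphere n)} (hA : MeasurableSet A) :
    ∀ᵐ P ∂(sphereArea n), P ∈ A → ∀ η : ENNReal, η ≠ 0 → ∀ᶠ s : ℝ in 𝓝[>] 0,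
      sphereArea n (cap P s \ A) ≤ η * sphereArea n (cap P s) := by
  rw [← ae_restrict_iff' hA]
  have := IsUnifLocDoublingMeasure.ae_tendsto_measure_inter_div (koranyiArea n) A 1
  refine this.mono fun P hP η hη => ?_
  have hsqrt : Tendsto (fun s : ℝ => √s) (𝓝[>] 0) (𝓝[>] 0) := by
    refine tendsto_nhdsWithin_iff.2 ⟨?_, ?_⟩
    · simpa using (Real.continuous_sqrt.tendsto 0).mono_left nhdsWithin_le_nhds
    · filter_upwards [self_mem_nhdsWithin] with s hs using Real.sqrt_pos.2 hs
  have hlim := hP (fun _ : ℝ => P) (fun s : ℝ => √s) hsqrt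
    (Eventually.of_forall fun s => Metric.mem_closedBall_self (by positivity))
  have hη1 : (1 : ENNReal) - η < 1 := ENNReal.sub_lt_self ENNReal.one_ne_top one_ne_zero hη
  filter_upwards [hlim.eventually (lt_mem_nhds hη1), self_mem_nhdsWithin] with s hs hs0
  have hs0 : 0 < s := hs0
  rw [koranyi_closedBall P (Real.sqrt_nonneg _), Real.sq_sqrt hs0.le] at hs
  change 1 - η < sphereArea n (A ∩ cap P s) / sphereArea n (cap P s) at hs
  have hfin : sphereArea n (cap P s) ≠ ⊤ := measure_ne_top _ _
  have hle : (1 - η) * sphereArea n (cap P s) ≤ sphereArea n (A ∩ cap P s) :=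
    ENNReal.mul_le_of_le_div hs.le
  have hsplit := measure_inter_add_sdiff (μ := sphereArea n) (cap P s) hA
  rw [Set.inter_comm] at hsplit
  rcases le_or_gt 1 η with h1 | h1
  · calc sphereArea n (cap P s \ A) ≤ sphereArea n (cap P s) := measure_mono Set.sdiff_subset
      _ ≤ η * sphereArea n (cap P s) := le_mul_of_one_le_left' h1
  · have hA' : sphereArea n (A ∩ cap P s) ≠ ⊤ := measure_ne_top _ _
    refine (ENNReal.add_le_add_iff_left hA').1 ?_
    rw [hsplit]
    calc sphereArea n (cap P s) = (1 - η) * sphereArea n (cap P s) + η * sphereArea n (cap P s) := by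
          rw [← add_mul, tsub_add_cancel_of_le h1.le, one_mul]
      _ ≤ _ := by gcongr

end Metric

/-! ### Averaging over circles: mean values and radial limits. -/

section Rotation

variable {n : ℕ}

lemma measurePreserving_smul_of_norm_eq_one {u : ℂ} (hu : ‖u‖ = 1) :
    MeasurePreserving (fun v : EuclideanSpace ℂ (Fin n) => u • v) volume volume := by
  have hu0 : u ≠ 0 := by rintro rfl; simp at hu
  let e : EuclideanSpace ℂ (Fin n) ≃ₗᵢ[ℝ] EuclideanSpace ℂ (Fin n) :=
    { toFun := fun v => u • v
      invFun := fun v => u⁻¹ • v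
      map_add' := fun v w => smul_add u v w
      map_smul' := fun r v => smul_comm u r v
      left_inv := fun v => inv_smul_smul₀ hu0 v
      right_inv := fun v => smul_inv_smul₀ hu0 v
      norm_map' := fun v => by
        change ‖u • v‖ = ‖v‖
        rw [norm_smul, hu, one_mul] }
  exact e.measurePreserving

/-- Tonelli and unitary invariance; this passes between circles in complex lines and volume in `ℂⁿ`.
-/
lemma lintegral_lintegral_rotation {H : EuclideanSpace ℂ (Fin n) → ENNReal} (hH : Measurable H) :
    ∫⁻ v, ∫⁻ θ in Set.Ioc 0 (2 * Real.pi), H (Complex.exp (θ * Complex.I) • v) =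
      ENNReal.ofReal (2 * Real.pi) * ∫⁻ v, H v := by
  rw [lintegral_lintegral_swap]
  · have h : ∀ θ : ℝ, ∫⁻ v, H (Complex.exp (θ * Complex.I) • v) = ∫⁻ v, H v := fun θ =>
      (measurePreserving_smul_of_norm_eq_one (Complex.norm_exp_ofReal_mul_I θ)).lintegral_comp hH
    simp_rw [h]
    rw [setLIntegral_const, Real.volume_Ioc, sub_zero, mul_comm]
  · refine (hH.comp ?_).aemeasurable
    have : Continuous fun x : EuclideanSpace ℂ (Fin n) × ℝ =>
      Complex.exp (x.2 * Complex.I) • x.1 := by fun_prop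
    exact this.measurable

/-- The sub-mean value property of `|g|`, for a holomorphic function `g`, over translates of
balanced sets. -/
lemma enorm_mul_volume_le_setLIntegral {g : EuclideanSpace ℂ (Fin n) → ℂ}
    (hg : DifferentiableOn ℂ g (Metric.ball 0 1)) (hgm : Measurable g)
    {Q : Set (EuclideanSpace ℂ (Fin n))} (hQ : MeasurableSet Q)
    (hbal : ∀ u : ℂ, ‖u‖ ≤ 1 → ∀ v ∈ Q, u • v ∈ Q) {z : EuclideanSpace ℂ (Fin n)}
    (hz : ∀ v ∈ Q, z + v ∈ Metric.ball (0 : EuclideanSpace ℂ (Fin n)) 1) :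
    ‖g z‖ₑ * volume Q ≤ ∫⁻ v in Q, ‖g (z + v)‖ₑ := by
  have hpi := Real.pi_pos
  -- Since `Q` is balanced, the whole disc `z + u • v`, `|u| ≤ 1`, stays in the ball, and the
  -- one-variable mean value property applies.
  have hmv : ∀ v ∈ Q, ENNReal.ofReal (2 * Real.pi) * ‖g z‖ₑ ≤
      ∫⁻ θ in Set.Ioc 0 (2 * Real.pi), ‖g (z + Complex.exp (θ * Complex.I) • v)‖ₑ := by
    intro v hv
    have hd : DifferentiableOn ℂ (fun u : ℂ => g (z + u • v)) (Metric.closedBall 0 1) := by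
      refine hg.comp (by fun_prop) fun u hu => hz _ (hbal u (by simpa using hu) v hv)
    have havg := (hd.mono Metric.closure_ball_subset_closedBall).diffContOnCl
    rw [← abs_one] at havg
    have h1 := havg.circleAverage
    rw [Real.circleAverage_def, inv_smul_eq_iff₀ (by positivity),
      intervalIntegral.integral_of_le (by positivity)] at h1
    have h2 := enorm_integral_le_lintegral_enorm
      (μ := volume.restrict (Set.Ioc 0 (2 * Real.pi))) (fun θ : ℝ => g (z + circleMap 0 1 θ • v))
    rw [h1, enorm_smul, zero_smul, add_zero, Real.enorm_eq_ofReal (by positivity)] at h2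
    simpa [circleMap] using h2
  have hHm : Measurable (Q.indicator fun v => ‖g (z + v)‖ₑ) :=
    (hgm.comp (measurable_const_add z)).enorm.indicator hQ
  have hrot := lintegral_lintegral_rotation hHm
  rw [lintegral_indicator hQ] at hrot
  have hc0 : ENNReal.ofReal (2 * Real.pi) ≠ 0 := by simpa using hpi
  refine (ENNReal.mul_le_mul_iff_right hc0 ENNReal.ofReal_ne_top).1 ?_
  rw [← hrot, ← mul_assoc, ← setLIntegral_const, ← lintegral_indicator hQ]
  refine lintegral_mono fun v => ?_
  by_cases hv : v ∈ Q
  · rw [Set.indicator_of_mem hv]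
    refine (hmv v hv).trans_eq (lintegral_congr fun θ => ?_)
    rw [Set.indicator_of_mem (hbal _ (Complex.norm_exp_ofReal_mul_I θ).le v hv)]
  · rw [Set.indicator_of_notMem hv]
    exact bot_le

/-- The directions along which `f` stays within `ε` of `q` at the radii in `(1 - 1 / (N + 1), 1)`. -/
def radialSet (f : EuclideanSpace ℂ (Fin n) → ℂ) (q : ℂ) (ε : ℝ) (N : ℕ) : Set (UnitSphere n) :=
  {ω | ∀ r ∈ Set.Ioo (1 - 1 / ((N : ℝ) + 1)) 1,
    ‖f ((r : ℂ) • (ω : EuclideanSpace ℂ (Fin n))) - q‖ ≤ ε}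

lemma isClosed_radialSet {f : EuclideanSpace ℂ (Fin n) → ℂ}
    (hf : ContinuousOn f (Metric.ball 0 1)) (q : ℂ) (ε : ℝ) (N : ℕ) :
    IsClosed (radialSet f q ε N) := by
  have : radialSet f q ε N = ⋂ r ∈ Set.Ioo (1 - 1 / ((N : ℝ) + 1)) 1,
      {ω : UnitSphere n | ‖f ((r : ℂ) • (ω : EuclideanSpace ℂ (Fin n))) - q‖ ≤ ε} := by
    ext ω; simp [radialSet]
  rw [this]
  refine isClosed_biInter fun r hr => isClosed_le ?_ continuous_const
  have h0 : 0 ≤ 1 - 1 / ((N : ℝ) + 1) := by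
    rw [sub_nonneg, div_le_one (by positivity)]
    linarith [Nat.cast_nonneg (α := ℝ) N]
  have hcomp : Continuous fun ω : UnitSphere n => f ((r : ℂ) • (ω : EuclideanSpace ℂ (Fin n))) := by
    refine hf.comp_continuous (by fun_prop) fun ω => ?_
    rw [mem_ball_zero_iff, norm_smul, norm_eq_of_mem_sphere ω, Complex.norm_real,
      Real.norm_of_nonneg (h0.trans hr.1.le), mul_one]
    exact hr.2
  exact (hcomp.sub continuous_const).norm

/-- Replacing the limit by a nearby point of a countable dense set leaves only countably many sets
to which the density theorem must be applied. -/
lemma exists_mem_radialSet_of_tendsto {f : EuclideanSpace ℂ (Fin n) → ℂ} {ω : UnitSphere n} {L : ℂ}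
    (h : Tendsto (fun r : ℝ => f ((r : ℂ) • (ω : EuclideanSpace ℂ (Fin n)))) (𝓝[<] 1) (𝓝 L))
    {ε : ℝ} (hε : 0 < ε) :
    ∃ j N, ω ∈ radialSet f (TopologicalSpace.denseSeq ℂ j) ε N := by
  obtain ⟨_, hq, j, rfl⟩ := Metric.dense_iff.1 (TopologicalSpace.denseRange_denseSeq ℂ) L (ε / 2)
    (by positivity)
  have h1 := (Metric.tendsto_nhds.1 h (ε / 2) (by positivity))
  obtain ⟨a, ha, ha'⟩ := (mem_nhdsLT_iff_exists_Ioo_subset).1 h1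
  obtain ⟨N, hN⟩ := exists_nat_one_div_lt (sub_pos.2 (Set.mem_Iio.1 ha))
  refine ⟨j, N, fun r hr => ?_⟩
  have h2 : dist (f ((r : ℂ) • (ω : EuclideanSpace ℂ (Fin n)))) L < ε / 2 :=
    ha' ⟨by linarith [hr.1], hr.2⟩
  rw [← dist_eq_norm]
  refine (dist_triangle _ L _).trans ?_
  rw [Metric.mem_ball, dist_comm] at hq
  linarith

/-- Almost every radial direction lies in one of the countably many sets `radialSet f q ε N`. -/
lemma ae_exists_mem_radialSet {f : EuclideanSpace ℂ (Fin n) → ℂ} {M : ℝ}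
    (hf : DifferentiableOn ℂ f (Metric.ball 0 1))
    (hfM : ∀ z ∈ Metric.ball (0 : EuclideanSpace ℂ (Fin n)) 1, ‖f z‖ ≤ M) {ε : ℝ} (hε : 0 < ε) :
    ∀ᵐ ω ∂(sphereArea n), ∃ j N, ω ∈ radialSet f (TopologicalSpace.denseSeq ℂ j) ε N := by
  set S := {ω : UnitSphere n | ∃ j N, ω ∈ radialSet f (TopologicalSpace.denseSeq ℂ j) ε N} with hS
  have hSm : MeasurableSet Sᶜ := by
    have : S = ⋃ j, ⋃ N, radialSet f (TopologicalSpace.denseSeq ℂ j) ε N := by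
      ext ω; simp [hS]
    rw [this]
    exact (MeasurableSet.iUnion fun j => MeasurableSet.iUnion fun N =>
      (isClosed_radialSet hf.continuousOn _ _ _).measurableSet).compl
  change sphereArea n Sᶜ = 0
  have hW := measurableSet_shell hSm 1
  have hrot := lintegral_lintegral_rotation (measurable_const.indicator hW : Measurable
    ((shell Sᶜ 1).indicator fun _ : EuclideanSpace ℂ (Fin n) => (1 : ENNReal)))
  -- Fatou's theorem on the complex line through `z`: almost no rotation of `z` falls in the cone
  -- over bad directions, so that cone has volume zero.
  have hzero : ∀ z : EuclideanSpace ℂ (Fin n), ∫⁻ θ in Set.Ioc 0 (2 * Real.pi),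
      (shell Sᶜ 1).indicator (fun _ => (1 : ENNReal)) (Complex.exp (θ * Complex.I) • z) = 0 := by
    intro z
    have hr1 : ‖(‖z‖ : ℂ)⁻¹ • z‖ ≤ 1 := by
      rw [norm_smul, norm_inv, Complex.norm_real, norm_norm]
      exact inv_mul_le_one
    have hmaps : ∀ u ∈ Metric.ball (0 : ℂ) 1, u • ((‖z‖ : ℂ)⁻¹ • z) ∈
        Metric.ball (0 : EuclideanSpace ℂ (Fin n)) 1 := by
      intro u hu
      rw [mem_ball_zero_iff] at hu ⊢
      rw [norm_smul]
      nlinarith [norm_nonneg u]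
    have hfat := ae_exists_tendsto_radial (g := fun u : ℂ => f (u • ((‖z‖ : ℂ)⁻¹ • z))) (M := M)
      (hf.comp (by fun_prop) hmaps) (fun u hu => hfM _ (hmaps u hu))
    rw [lintegral_eq_zero_iff']
    · refine ae_restrict_of_ae (hfat.mono ?_)
      rintro θ ⟨L, hL⟩
      refine Set.indicator_of_notMem (fun hmem => ?_) _
      obtain ⟨ω, hω, r, hr0, -, hr1, hzω⟩ := mem_shell.1 hmem
      apply hω
      have hnorm : ‖z‖ = r := by
        have := congrArg norm hzω
        rwa [norm_smul, norm_smul, Complex.norm_exp_ofReal_mul_I, norm_eq_of_mem_sphere ω,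
          Complex.norm_real, Real.norm_of_nonneg hr0.le, one_mul, mul_one] at this
      have hr0' : (r : ℂ) ≠ 0 := by exact_mod_cast hr0.ne'
      have hωz : (ω : EuclideanSpace ℂ (Fin n)) =
          Complex.exp (θ * Complex.I) • ((‖z‖ : ℂ)⁻¹ • z) := by
        rw [smul_comm, hzω, hnorm, inv_smul_smul₀ hr0']
      refine exists_mem_radialSet_of_tendsto (L := L) ?_ hε
      rw [hωz]
      simpa only [mul_smul] using hL
    · refine Measurable.aemeasurable ?_
      refine (measurable_const.indicator hW).comp ?_
      have : Continuous fun θ : ℝ => Complex.exp (θ * Complex.I) • z := by fun_prop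
      exact this.measurable
  simp_rw [hzero] at hrot
  rw [lintegral_zero, lintegral_indicator_const hW, one_mul, volume_shell] at hrot
  have hpi := Real.pi_pos
  have hc0 : ENNReal.ofReal (2 * Real.pi) ≠ 0 := by simpa using hpi
  have h0 := (mul_eq_zero.1 hrot.symm).resolve_left hc0
  rcases mul_eq_zero.1 h0 with h | h
  · exact h
  -- The sphere is empty when `n = 0`.
  · rcases isEmpty_or_nonempty (UnitSphere n) with he | ⟨⟨P⟩⟩
    · rw [Set.eq_empty_of_isEmpty Sᶜ, measure_empty]
    · exact absurd h (volume_shellRadii_ne_zero P one_pos le_rfl)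

end Rotation

/-! ### From density points to admissible limits. -/

section AdmissibleLimit

variable {n : ℕ}

/-- A box of size comparable to `1 - |z|` centred at `z ∈ 𝒜_α(P)` lies in a comparable tent. -/
lemma add_mem_tent_of_mem_admissibleRegion {P z v : EuclideanSpace ℂ (Fin n)} (hP : ‖P‖ = 1)
    {α t : ℝ} (hα : 1 < α) (hz : z ∈ admissibleRegion α P) (ht : 0 < t) (ht2 : t ^ 2 = 1 - ‖z‖)
    (hv : v ∈ box P (1 / (16 * α) * t ^ 2) (1 / (16 * α) * t)) :
    z + v ∈ tent P (2 * α * t ^ 2) := by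
  obtain ⟨hz1, hz2⟩ := hz
  rw [mem_ball_zero_iff] at hz1
  rw [← ht2] at hz2
  set c := 1 / (16 * α) with hc
  have hc0 : 0 < c := by positivity
  have hcα : c * α = 1 / 16 := by rw [hc]; field_simp
  have hc1 : c ≤ 1 / 16 := by nlinarith
  have hpos : 0 < t ^ 2 := by positivity
  have hcv : c * t ^ 2 ≤ 1 / 16 * t ^ 2 := by gcongr
  constructor
  · apply lt_of_pow_lt_pow_left₀ 2 (by norm_num)
    have hzP : ‖z - P‖ ≤ 2 * α * t := by
      apply le_of_sq_le_sq _ (by positivity)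
      have := norm_sub_sq_le_of_mem_tent hP hz1.le
      have hα2 : α * t ^ 2 ≤ α ^ 2 * t ^ 2 := by gcongr; nlinarith
      nlinarith
    -- The box is adapted to `P`, not to `z`. The error `|z - P| |v|` is at most `2αt * ct = t² /
    -- 8`, which dictates `c = 1 / (16α)`.
    have hzv : ‖inner ℂ z v‖ ≤ 3 / 16 * t ^ 2 := by
      have e : inner ℂ z v = inner ℂ P v + inner ℂ (z - P) v := by rw [inner_sub_left]; ring
      rw [e]
      refine (norm_add_le _ _).trans ?_
      have h1 := norm_inner_le_norm (𝕜 := ℂ) (z - P) v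
      have h2 : ‖z - P‖ * ‖v‖ ≤ (2 * α * t) * (c * t) := by gcongr; exact hv.2.le
      have h3 : (2 * α * t) * (c * t) = 2 / 16 * t ^ 2 := by
        calc (2 * α * t) * (c * t) = 2 * (c * α) * t ^ 2 := by ring
          _ = _ := by rw [hcα]; ring
      linarith [hv.1]
    have hv2 : ‖v‖ ^ 2 ≤ (1 / 16 * t) ^ 2 := by
      gcongr
      exact hv.2.le.trans (by gcongr)
    have hre : RCLike.re (inner ℂ z v) ≤ 3 / 16 * t ^ 2 := (RCLike.re_le_norm _).trans hzv
    rw [@norm_add_sq ℂ]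
    have hzt : ‖z‖ = 1 - t ^ 2 := by linarith
    have ht1 : t ^ 2 ≤ 1 := by linarith [norm_nonneg z]
    rw [hzt]
    nlinarith
  · rw [inner_add_right, ← sub_sub]
    refine (norm_sub_le _ _).trans_lt ?_
    have := hv.1
    nlinarith

/-- At a nonisotropic density point of a set of directions along which `f` is radially close to
`q`, the function `f` is close to `q` in the admissible approach regions. -/
lemma eventually_norm_sub_le_admissibleRegion {f : EuclideanSpace ℂ (Fin n) → ℂ} {M : ℝ}
    (hf : DifferentiableOn ℂ f (Metric.ball 0 1))
    (hfM : ∀ z ∈ Metric.ball (0 : EuclideanSpace ℂ (Fin n)) 1, ‖f z‖ ≤ M) {P : UnitSphere n}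
    {q : ℂ} {ε : ℝ} (hε : 0 < ε) {N : ℕ}
    (hP : ∀ η : ENNReal, η ≠ 0 → ∀ᶠ s : ℝ in 𝓝[>] 0,
      sphereArea n (cap P s \ radialSet f q ε N) ≤ η * sphereArea n (cap P s))
    {α : ℝ} (hα : 1 < α) :
    ∀ᶠ z in 𝓝[admissibleRegion α (P : EuclideanSpace ℂ (Fin n))] (P : EuclideanSpace ℂ (Fin n)),
      ‖f z - q‖ ≤ 2 * ε := by
  classical
  have hP1 : ‖(P : EuclideanSpace ℂ (Fin n))‖ = 1 := norm_eq_of_mem_sphere P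
  set A := radialSet f q ε N with hA
  have hAm : MeasurableSet A := (isClosed_radialSet hf.continuousOn _ _ _).measurableSet
  set c := 1 / (16 * α) with hc
  have hc0 : 0 < c := by positivity
  -- Extension by zero makes the function globally measurable.
  set g := (Metric.ball (0 : EuclideanSpace ℂ (Fin n)) 1).indicator (fun z => f z - q) with hg
  have hgd : DifferentiableOn ℂ g (Metric.ball 0 1) :=
    (hf.sub_const q).congr fun z hz => Set.indicator_of_mem hz _
  have hgm : Measurable g := by
    rw [hg, ← Set.piecewise_eq_indicator]
    exact (hf.sub_const q).continuousOn.measurable_piecewise continuousOn_const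
      Metric.isOpen_ball.measurableSet
  obtain ⟨K, hK, hKle⟩ := exists_volume_tent_le_box n (k := 6 * α) (by positivity) hc0
  set M' : ENNReal := ENNReal.ofReal (M + ‖q‖)
  -- The admissible density defect: bad directions will contribute at most `M' * (η * K)` to the
  -- mean. The `+ 1` in the witness avoids division by zero.
  obtain ⟨η, hη0, hη⟩ : ∃ η : ENNReal, η ≠ 0 ∧ M' * (η * K) ≤ ENNReal.ofReal ε := by
    refine ⟨ENNReal.ofReal ε / (M' * K + 1), ?_, ?_⟩
    · refine (ENNReal.div_pos (by simpa using hε) ?_).ne'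
      exact ENNReal.add_ne_top.2 ⟨ENNReal.mul_ne_top ENNReal.ofReal_ne_top hK, ENNReal.one_ne_top⟩
    · calc M' * (ENNReal.ofReal ε / (M' * K + 1) * K)
          = ENNReal.ofReal ε / (M' * K + 1) * (M' * K) := by ring
        _ ≤ ENNReal.ofReal ε / (M' * K + 1) * (M' * K + 1) := by gcongr; exact le_self_add
        _ ≤ ENNReal.ofReal ε := by rw [mul_comm]; exact ENNReal.mul_div_le
  have hlim : Tendsto (fun z : EuclideanSpace ℂ (Fin n) => 4 * α * (1 - ‖z‖))
      (𝓝[admissibleRegion α (P : EuclideanSpace ℂ (Fin n))] (P : EuclideanSpace ℂ (Fin n)))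
      (𝓝[>] 0) := by
    refine tendsto_nhdsWithin_iff.2 ⟨?_, ?_⟩
    · have : Continuous fun z : EuclideanSpace ℂ (Fin n) => 4 * α * (1 - ‖z‖) := by fun_prop
      have h := (this.tendsto (P : EuclideanSpace ℂ (Fin n))).mono_left
        (nhdsWithin_le_nhds (s := admissibleRegion α (P : EuclideanSpace ℂ (Fin n))))
      simpa [hP1] using h
    · filter_upwards [self_mem_nhdsWithin] with z hz
      have := mem_ball_zero_iff.1 hz.1
      have : 0 < 1 - ‖z‖ := by linarith
      exact Set.mem_Ioi.2 (by positivity)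
  have hsmall : ∀ᶠ s : ℝ in 𝓝[>] 0, s < 1 / ((N : ℝ) + 1) :=
    nhdsWithin_le_nhds (gt_mem_nhds (by positivity))
  filter_upwards [hlim.eventually (hP η hη0), hlim.eventually hsmall, self_mem_nhdsWithin]
    with z hzη hzN hz
  have hz1 : ‖z‖ < 1 := mem_ball_zero_iff.1 hz.1
  set t := √(1 - ‖z‖)
  have ht2 : t ^ 2 = 1 - ‖z‖ := Real.sq_sqrt (by linarith)
  have ht : 0 < t := Real.sqrt_pos.2 (by linarith)
  have ht1 : t ≤ 1 := by nlinarith [norm_nonneg z]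
  rw [← ht2] at hzη hzN
  set ρ := 2 * α * t ^ 2 with hρ
  have hρ2 : 4 * α * t ^ 2 = 2 * ρ := by rw [hρ]; ring
  rw [hρ2] at hzη hzN
  have hρ0 : 0 < ρ := by positivity
  have hN1 : 1 / ((N : ℝ) + 1) ≤ 1 := by
    rw [div_le_one (by positivity)]; linarith [Nat.cast_nonneg (α := ℝ) N]
  set Q := box (P : EuclideanSpace ℂ (Fin n)) (c * t ^ 2) (c * t)
  have hQo : IsOpen Q := isOpen_box _ _ _
  have hQt : ∀ v ∈ Q, z + v ∈ tent (P : EuclideanSpace ℂ (Fin n)) ρ := fun v hv =>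
    add_mem_tent_of_mem_admissibleRegion hP1 hα hz ht ht2 hv
  have hQb : ∀ v ∈ Q, z + v ∈ Metric.ball (0 : EuclideanSpace ℂ (Fin n)) 1 := fun v hv =>
    mem_ball_zero_iff.2 (hQt v hv).1
  have hbal : ∀ u : ℂ, ‖u‖ ≤ 1 → ∀ v ∈ Q, u • v ∈ Q := by
    intro u hu v hv
    constructor
    · rw [inner_smul_right, norm_mul]
      exact (mul_le_of_le_one_left (norm_nonneg _) hu).trans_lt hv.1
    · rw [norm_smul]
      exact (mul_le_of_le_one_left (norm_nonneg _) hu).trans_lt hv.2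
  have hQ0 : volume Q ≠ 0 := by
    refine (hQo.measure_pos _ ⟨0, ?_, ?_⟩).ne'
    · rw [inner_zero_right, norm_zero]; positivity
    · rw [norm_zero]; positivity
  have hQtop : volume Q ≠ ⊤ := by
    refine ne_top_of_le_ne_top (measure_ball_lt_top (μ := volume)
      (x := (0 : EuclideanSpace ℂ (Fin n))) (r := c * t)).ne (measure_mono fun v hv => ?_)
    exact mem_ball_zero_iff.2 hv.2
  -- The points over bad directions. Their shell lies in a tent of size `2ρ + ρ = 6αt²`, which is
  -- why `K` was taken for `6 * α`.
  set X := shell (cap P (2 * ρ) \ A) ρ with hX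
  have hXm : MeasurableSet X := measurableSet_shell ((isClosed_cap P _).measurableSet.diff hAm) _
  have hXle : volume X ≤ η * K * volume Q := by
    calc volume X ≤ η * volume (shell (cap P (2 * ρ)) ρ) := by
          rw [hX, volume_shell, volume_shell, ← mul_assoc η]
          exact mul_le_mul_left hzη _
      _ ≤ η * volume (tent (P : EuclideanSpace ℂ (Fin n)) (6 * α * t ^ 2)) := by
          gcongr
          convert shell_cap_subset_tent P (2 * ρ) ρ using 2
          rw [hρ]; ring
      _ ≤ η * (K * volume Q) := by
          gcongr
          exact hKle _ t hP1 ht ht1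
      _ = η * K * volume Q := by ring
  have hpt : ∀ v ∈ Q, ‖g (z + v)‖ₑ ≤
      ENNReal.ofReal ε + ((fun v => z + v) ⁻¹' X).indicator (fun _ => M') v := by
    intro v hv
    have hgv : g (z + v) = f (z + v) - q := Set.indicator_of_mem (hQb v hv) _
    rw [hgv, ← ofReal_norm]
    by_cases hvX : z + v ∈ X
    · rw [Set.indicator_of_mem (show v ∈ (fun v => z + v) ⁻¹' X from hvX)]
      refine le_trans (ENNReal.ofReal_le_ofReal ?_) le_add_self
      exact (norm_sub_le _ _).trans (by gcongr; exact hfM _ (hQb v hv))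
    · refine le_trans (ENNReal.ofReal_le_ofReal ?_) le_self_add
      obtain ⟨ω, hω, r, hr0, hr1, hr2, hzv⟩ := exists_polar_of_mem_tent (by linarith) (hQt v hv)
      have hωA : ω ∈ A := by
        by_contra hωA
        exact hvX (mem_shell.2 ⟨ω, ⟨hω, hωA⟩, r, hr0, hr1, hr2, hzv⟩)
      rw [hzv]
      exact hωA r ⟨by linarith, hr2⟩
  have hmean := enorm_mul_volume_le_setLIntegral hgd hgm hQo.measurableSet hbal hQb
  have hint : ∫⁻ v in Q, ‖g (z + v)‖ₑ ≤ ENNReal.ofReal (2 * ε) * volume Q := by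
    have hpre : MeasurableSet ((fun v => z + v) ⁻¹' X) := measurable_const_add z hXm
    calc ∫⁻ v in Q, ‖g (z + v)‖ₑ
        ≤ ∫⁻ v in Q, (ENNReal.ofReal ε + ((fun v => z + v) ⁻¹' X).indicator (fun _ => M') v) :=
          setLIntegral_mono' hQo.measurableSet hpt
      _ ≤ ENNReal.ofReal ε * volume Q + ∫⁻ v, ((fun v => z + v) ⁻¹' X).indicator (fun _ => M') v := by
          rw [lintegral_add_left measurable_const, setLIntegral_const]
          exact add_le_add le_rfl (setLIntegral_le_lintegral _ _)
      _ = ENNReal.ofReal ε * volume Q + M' * volume X := by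
          rw [lintegral_indicator_const hpre, measure_preimage_add]
      _ ≤ ENNReal.ofReal ε * volume Q + M' * (η * K * volume Q) := by gcongr
      _ = (ENNReal.ofReal ε + M' * (η * K)) * volume Q := by ring
      _ ≤ (ENNReal.ofReal ε + ENNReal.ofReal ε) * volume Q := by gcongr
      _ = ENNReal.ofReal (2 * ε) * volume Q := by
          rw [← ENNReal.ofReal_add hε.le hε.le, two_mul]
  have hfin := (ENNReal.mul_le_mul_iff_left hQ0 hQtop).1 (hmean.trans hint)
  have hgz : g z = f z - q := Set.indicator_of_mem hz.1 _
  rw [hgz, ← ofReal_norm] at hfin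
  exact (ENNReal.ofReal_le_ofReal_iff (by positivity)).1 hfin

/-- **Korányi's theorem**: bounded holomorphic functions on the unit ball of `ℂⁿ` have admissible
limits almost everywhere. -/
theorem ae_hasAdmissibleLimitAt {f : EuclideanSpace ℂ (Fin n) → ℂ} {M : ℝ}
    (hf : DifferentiableOn ℂ f (Metric.ball 0 1))
    (hfM : ∀ z ∈ Metric.ball (0 : EuclideanSpace ℂ (Fin n)) 1, ‖f z‖ ≤ M) :
    ∀ᵐ P : UnitSphere n ∂(sphereArea n), HasAdmissibleLimitAt f (P : EuclideanSpace ℂ (Fin n)) := by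
  have h1 : ∀ᵐ P ∂(sphereArea n), ∀ k : ℕ, ∃ j N,
      P ∈ radialSet f (TopologicalSpace.denseSeq ℂ j) (1 / ((k : ℝ) + 1)) N :=
    ae_all_iff.2 fun k => ae_exists_mem_radialSet hf hfM (by positivity)
  have h2 : ∀ᵐ P ∂(sphereArea n), ∀ k j N : ℕ,
      P ∈ radialSet f (TopologicalSpace.denseSeq ℂ j) (1 / ((k : ℝ) + 1)) N →
      ∀ η : ENNReal, η ≠ 0 → ∀ᶠ s : ℝ in 𝓝[>] 0, sphereArea n
        (cap P s \ radialSet f (TopologicalSpace.denseSeq ℂ j) (1 / ((k : ℝ) + 1)) N) ≤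
          η * sphereArea n (cap P s) :=
    ae_all_iff.2 fun k => ae_all_iff.2 fun j => ae_all_iff.2 fun N =>
      ae_eventually_sphereArea_cap_diff_le (isClosed_radialSet hf.continuousOn _ _ _).measurableSet
  filter_upwards [h1, h2] with P hP1 hP2 α hα
  -- A Cauchy filter must be nontrivial.
  rcases eq_or_neBot
    (𝓝[admissibleRegion α (P : EuclideanSpace ℂ (Fin n))] (P : EuclideanSpace ℂ (Fin n))) with
    hbot | hne
  · exact ⟨0, by rw [hbot]; exact tendsto_bot⟩
  rw [← cauchy_map_iff_exists_tendsto, Metric.cauchy_iff]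
  refine ⟨inferInstance, fun ε hε => ?_⟩
  -- Both values lie within `2 / (k + 1) < ε / 2` of the same centre.
  obtain ⟨k, hk⟩ := exists_nat_one_div_lt (show 0 < ε / 4 by positivity)
  obtain ⟨j, N, hjN⟩ := hP1 k
  have hev := eventually_norm_sub_le_admissibleRegion hf hfM (by positivity)
    (hP2 k j N hjN) hα
  refine ⟨_, image_mem_map hev, ?_⟩
  rintro _ ⟨x, hx, rfl⟩ _ ⟨y, hy, rfl⟩
  refine (dist_triangle_right _ _ (TopologicalSpace.denseSeq ℂ j)).trans_lt ?_
  rw [dist_eq_norm, dist_eq_norm]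
  have hx : ‖f x - TopologicalSpace.denseSeq ℂ j‖ ≤ 2 * (1 / ((k : ℝ) + 1)) := hx
  have hy : ‖f y - TopologicalSpace.denseSeq ℂ j‖ ≤ 2 * (1 / ((k : ℝ) + 1)) := hy
  linarith

end AdmissibleLimit

theorem proposition9 (n : ℕ) (f : EuclideanSpace ℂ (Fin n) → ℂ)
    (hf : DifferentiableOn ℂ f (Metric.ball (0 : EuclideanSpace ℂ (Fin n)) 1))
    (M : ℝ) (hM : 0 < M)
    (hfM : ∀ z ∈ Metric.ball (0 : EuclideanSpace ℂ (Fin n)) 1, ‖f z‖ ≤ M)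
    (E : Set (Metric.sphere (0 : EuclideanSpace ℂ (Fin n)) 1))
    (hE : 0 < sphereArea n E)
    (hfE : AdmissiblyBoundedOn f E) :
    ∀ᵐ P ∂(sphereArea n), P ∈ E →
      HasAdmissibleLimitAt f (P : EuclideanSpace ℂ (Fin n)) := by
  filter_upwards [ae_hasAdmissibleLimitAt hf hfM] with P hP _ using hP
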